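/- Let $0 < p < 2$ and let $B_p^n = \{x \in \mathbb{R}^n : (\sum_{j=1}^n |x_j|^p)^{1/p} \le 1\}$. For every two unit vectors $a$ and $b$ in Euclidean space $\mathbb{R}^n$ such that $(b_1^2, \dots, b_n^2)$ majorises $(a_1^2, \dots, a_n^2)$, we have $$\mathrm{vol}_{n-1}(B_p^n \cap a^\perp) \le \mathrm{vol}_{n-1}(B_p^n \cap b^\perp).$$ Here $u^\perp$ is the hyperplane $\{x \in \mathbb{R}^n : \langle x, u\rangle = 0\}$, and $\mathrm{vol}_{n-1}$ is $(n-1)$-dimensional Hausdorff measure on $\mathbb{R}^n$, normalised so that $(n-1)$-dimensional cubes of side length $1$ have measure $1$. A vector $y \in \mathbb{R}^n$ majorises $x \in \mathbb{R}^n$ if $\sum_{i=1}^n x_i = \sum_{i=1}^n y_i$ and, for each $k = 1, \dots, n$, the sum of the $k$ largest entries of $x$ is at most the sum of the $k$ largest entries of $y$. -/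

import Mathlib

open scoped MeasureTheory

noncomputable section

/-- The `ℓ_p`-norm (quasinorm when `0 < p < 1`) of a vector in `ℝⁿ`, for real `p > 0`. -/
def ellNorm {n : ℕ} (p : ℝ) (x : EuclideanSpace ℝ (Fin n)) : ℝ :=
  (∑ j, |x j| ^ p) ^ (1 / p)

/-- The closed unit ball `B_p^n` of the `ℓ_p`-norm, as a subset of Euclidean space `ℝⁿ`. -/
def ellBall (n : ℕ) (p : ℝ) : Set (EuclideanSpace ℝ (Fin n)) :=
  {x | ellNorm p x ≤ 1}

/-- The hyperplane `a^⊥` of vectors orthogonal to `a`. -/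
def perp {n : ℕ} (a : EuclideanSpace ℝ (Fin n)) : Set (EuclideanSpace ℝ (Fin n)) :=
  {x | inner ℝ x a = 0}

/-- The entries of `x` listed in nonincreasing order: `x↓₀ ≥ x↓₁ ≥ … ≥ x↓ₙ₋₁`.
(`Tuple.sort x` is a permutation that lists them in nondecreasing order.) -/
def decreasing {n : ℕ} (x : Fin n → ℝ) : Fin n → ℝ :=
  fun i => x (Tuple.sort x i.rev)

/-- `y` majorises `x`: the sum of the `k` largest entries of `x` is at most that of `y`, for
every `k ≤ n`, and the sums of all entries agree. -/
def Majorises {n : ℕ} (y x : Fin n → ℝ) : Prop :=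
  (∀ k ≤ n, ∑ i ∈ Finset.univ.filter (fun i : Fin n => (i : ℕ) < k), decreasing x i ≤
    ∑ i ∈ Finset.univ.filter (fun i : Fin n => (i : ℕ) < k), decreasing y i) ∧
  ∑ i, x i = ∑ i, y i

end

open MeasureTheory Real Filter Topology
open scoped ENNReal Pointwise

/-! Integrating `exp (-∑ |x j| ^ p)` over `a^⊥` in layers gives the volume of the section times a
finite positive factor depending only on `n` and `p` (`lintegral_exp_neg_perp`), so it suffices to
compare these integrals.

For a Gaussian `exp (-∑ s j * x j ^ 2)` and a unit vector `a`, the integral over `a^⊥` is a factor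
independent of `a` times `(π * ∑ a j ^ 2 / s j) ^ (-1/2)`, a convex function of the squares `a j ^
2`. By Rado's theorem these squares are a convex combination of rearrangements of the `b j ^ 2`.
Hence the integral over `a^⊥` is at most a weighted average of the integrals over the hyperplanes
normal to rearrangements of `b` (`lintegral_gaussianWeight_perp_le`).

Since `0 < p / 2 < 1`, the function `exp (-∑ |x j| ^ p)` is a limit of positive mixtures of
Gaussians, and so inherits the inequality (`lintegral_exp_neg_sum_abs_rpow_le`). The ball is
invariant under permutations of the coordinates, so all sections in the average have the volume of
the section by `b^⊥`. -/

/-! ### Majorisation and Rado's theorem. -/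

/-- Abel summation: a nonincreasing weight against a sequence with nonnegative partial sums. -/
lemma sum_mul_nonneg_of_partial_sums {n : ℕ} (r z : ℕ → ℝ) (hr : Antitone r)
    (hz : ∀ k ≤ n, 0 ≤ ∑ i ∈ Finset.range k, z i) (hzn : ∑ i ∈ Finset.range n, z i = 0) :
    0 ≤ ∑ i ∈ Finset.range n, r i * z i := by
  -- The left side is the boundary term of summation by parts; keeping it makes the induction close.
  -- At `k = 0` the truncated index is harmless, since the sum is empty.
  have key : ∀ k ≤ n, r (k - 1) * ∑ i ∈ Finset.range k, z i ≤ ∑ i ∈ Finset.range k, r i * z i := by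
    intro k
    induction k with
    | zero => simp
    | succ k ih =>
      intro hk
      rw [Finset.sum_range_succ, Finset.sum_range_succ]
      have h1 := ih (by omega)
      have h2 := mul_le_mul_of_nonneg_right (hr (Nat.sub_le k 1)) (hz k (by omega))
      simp only [Nat.add_sub_cancel]
      linarith
  simpa [hzn] using key n le_rfl

lemma sum_mul_le_of_partial_sums_le {n : ℕ} {r x y : Fin n → ℝ} (hr : Antitone r)
    (hxy : ∀ k ≤ n, ∑ i ∈ Finset.univ.filter (fun i : Fin n => (i : ℕ) < k), x i ≤
      ∑ i ∈ Finset.univ.filter (fun i : Fin n => (i : ℕ) < k), y i)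
    (hsum : ∑ i, x i = ∑ i, y i) : ∑ i, r i * x i ≤ ∑ i, r i * y i := by
  rcases Nat.eq_zero_or_pos n with rfl | hn
  · simp
  -- Clamping the index extends `r` to a sequence antitone on all of `ℕ`.
  let e : ℕ → Fin n := fun i => ⟨min i (n - 1), by omega⟩
  have he : ∀ i : Fin n, e i = i := fun i => Fin.ext (by simp only [e]; omega)
  have hmono : Monotone e := fun i j h => by
    simp only [e, Fin.mk_le_mk]; omega
  have hpart : ∀ k ≤ n, ∀ f : Fin n → ℝ,
      ∑ i ∈ Finset.range k, f (e i) =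
        ∑ i ∈ Finset.univ.filter (fun i : Fin n => (i : ℕ) < k), f i := by
    intro k hk f
    symm
    refine Finset.sum_bij (fun i _ => (i : ℕ)) ?_ ?_ ?_ ?_
    · intro i hi; simpa using hi
    · intro i _ j _ h; exact Fin.ext h
    · intro i hi
      have : i < k := by simpa using hi
      exact ⟨⟨i, by omega⟩, by simpa using this, rfl⟩
    · intro i _; rw [he]
  have hfull : ∀ f : Fin n → ℝ, ∑ i ∈ Finset.range n, f (e i) = ∑ i, f i := by
    intro f
    rw [hpart n le_rfl, Finset.filter_true_of_mem (fun i _ => i.2)]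
  have := sum_mul_nonneg_of_partial_sums (n := n) (fun i => r (e i))
    (fun i => (y - x) (e i)) (hr.comp_monotone hmono)
    (fun k hk => by
      rw [hpart k hk (y - x)]
      simpa [Finset.sum_sub_distrib] using hxy k hk)
    (by rw [hfull (y - x)]; simp [hsum])
  rw [hfull (fun i => r i * (y - x) i)] at this
  simpa [mul_sub] using this

lemma antitone_decreasing {n : ℕ} (x : Fin n → ℝ) : Antitone (decreasing x) :=
  (Tuple.monotone_sort x).comp_antitone Fin.rev_anti

lemma exists_perm_decreasing {n : ℕ} (x : Fin n → ℝ) :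
    ∃ σ : Equiv.Perm (Fin n), decreasing x = x ∘ σ :=
  ⟨Fin.revPerm.trans (Tuple.sort x), rfl⟩

/-- If `y` majorises `x`, then each linear functional of `x` is dominated by its value at some
rearrangement of `y`. -/
lemma Majorises.exists_perm_sum_mul_le {n : ℕ} {x y : Fin n → ℝ} (h : Majorises y x)
    (r : Fin n → ℝ) : ∃ τ : Equiv.Perm (Fin n), ∑ i, r i * x i ≤ ∑ i, r i * y (τ i) := by
  obtain ⟨σr, hr⟩ := exists_perm_decreasing r
  obtain ⟨σx, hx⟩ := exists_perm_decreasing x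
  obtain ⟨σy, hy⟩ := exists_perm_decreasing y
  -- This permutation pairs the largest entry of `y` with the largest of `r`, and so on down. The
  -- rearrangement inequality and Abel summation then give the bound.
  refine ⟨σr.symm.trans σy, ?_⟩
  have hsx : ∑ i, decreasing x i = ∑ i, x i := by rw [hx]; exact Equiv.sum_comp σx x
  have hsy : ∑ i, decreasing y i = ∑ i, y i := by rw [hy]; exact Equiv.sum_comp σy y
  have h1 : ∑ i, r i * x i ≤ ∑ i, decreasing r i * decreasing x i := by
    have hmv : Monovary (decreasing r) (decreasing x) :=
      (antitone_decreasing r).monovary (antitone_decreasing x)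
    have := hmv.sum_mul_comp_perm_le_sum_mul (σ := σr.trans σx.symm)
    refine le_trans (le_of_eq ?_) this
    rw [hr, hx, ← Equiv.sum_comp σr]
    simp
  have h2 := sum_mul_le_of_partial_sums_le (antitone_decreasing r) h.1
    (by rw [hsx, hsy, h.2])
  refine h1.trans (h2.trans (le_of_eq ?_))
  rw [hr, hy, ← Equiv.sum_comp σr (fun i => r i * y ((σr.symm.trans σy) i))]
  simp

/-- Rado's theorem: a vector majorised by `y` is a convex combination of rearrangements of `y`. -/
theorem Majorises.exists_weights {n : ℕ} {x y : Fin n → ℝ} (h : Majorises y x) :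
    ∃ w : Equiv.Perm (Fin n) → ℝ, (∀ τ, 0 ≤ w τ) ∧ ∑ τ, w τ = 1 ∧
      ∀ i, x i = ∑ τ, w τ * y (τ i) := by
  have hmem : x ∈ convexHull ℝ (Set.range fun τ : Equiv.Perm (Fin n) => y ∘ τ) := by
    by_contra hx
    -- A functional separating `x` from the hull would exceed at `x` its values at all
    -- rearrangements of `y`.
    obtain ⟨f, u, hu, hux⟩ := geometric_hahn_banach_closed_point (convex_convexHull ℝ _)
      ((Set.finite_range fun τ : Equiv.Perm (Fin n) => y ∘ τ).isClosed_convexHull ℝ) hx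
    have hf : ∀ v : Fin n → ℝ, f v = ∑ i, f (Pi.single i 1) * v i := by
      intro v
      conv_lhs => rw [pi_eq_sum_univ' v]
      simp [map_sum, mul_comm]
    obtain ⟨τ, hτ⟩ := h.exists_perm_sum_mul_le (fun i => f (Pi.single i 1))
    have := hu (y ∘ τ) (subset_convexHull ℝ _ ⟨τ, rfl⟩)
    rw [hf] at this hux
    simp only [Function.comp_apply] at this
    linarith
  rw [convexHull_range_eq_exists_affineCombination] at hmem
  obtain ⟨s, w, hw0, hw1, hx⟩ := hmem
  rw [Finset.affineCombination_eq_linear_combination _ _ _ hw1] at hx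
  classical
  refine ⟨fun τ => if τ ∈ s then w τ else 0, fun τ => ?_, ?_, fun i => ?_⟩
  · dsimp only
    split_ifs with h
    exacts [hw0 τ h, le_rfl]
  · simpa [Finset.sum_ite_mem] using hw1
  · rw [← hx]
    simp [Finset.sum_ite_mem, ite_mul]

/-! ### Hausdorff measure on a hyperplane and Fubini. -/

lemma coe_orthogonal_span_singleton {n : ℕ} (a : EuclideanSpace ℝ (Fin n)) :
    (((Submodule.span ℝ {a})ᗮ : Submodule ℝ (EuclideanSpace ℝ (Fin n))) :
      Set (EuclideanSpace ℝ (Fin n))) = perp a := by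
  ext x
  exact Submodule.mem_orthogonal_singleton_iff_inner_left

lemma map_subtype_volume_orthogonal {n : ℕ} {a : EuclideanSpace ℝ (Fin n)} (ha : a ≠ 0) :
    (volume : Measure ((Submodule.span ℝ {a})ᗮ : Submodule ℝ (EuclideanSpace ℝ (Fin n)))).map
      Subtype.val = (μHE[n - 1]).restrict (perp a) := by
  have hrank : Module.finrank ℝ
      ((Submodule.span ℝ {a})ᗮ : Submodule ℝ (EuclideanSpace ℝ (Fin n))) = n - 1 := by
    have h := (Submodule.span ℝ {a}).finrank_add_finrank_orthogonal
    rw [finrank_span_singleton ha, finrank_euclideanSpace_fin] at h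
    omega
  rw [← InnerProductSpace.euclideanHausdorffMeasure_eq_volume, hrank,
    isometry_subtype_coe.map_euclideanHausdorffMeasure, Subtype.range_coe_subtype]
  congr 1
  exact coe_orthogonal_span_singleton a

lemma lintegral_restrict_perp {n : ℕ} {a : EuclideanSpace ℝ (Fin n)} (ha : a ≠ 0)
    (f : EuclideanSpace ℝ (Fin n) → ℝ≥0∞) :
    ∫⁻ x in perp a, f x ∂μHE[n - 1] =
      ∫⁻ y : ((Submodule.span ℝ {a})ᗮ : Submodule ℝ (EuclideanSpace ℝ (Fin n))), f y := by
  rw [← map_subtype_volume_orthogonal ha]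
  refine MeasurableEmbedding.lintegral_map (MeasurableEmbedding.subtype_coe ?_) f
  exact (Submodule.closed_of_finiteDimensional _).measurableSet

lemma sFinite_restrict_perp {n : ℕ} {a : EuclideanSpace ℝ (Fin n)} (ha : a ≠ 0) :
    SFinite ((μHE[n - 1] : Measure (EuclideanSpace ℝ (Fin n))).restrict (perp a)) := by
  rw [← map_subtype_volume_orthogonal ha]
  infer_instance

/-- Fubini's theorem along the direction of a unit vector. -/
lemma lintegral_eq_lintegral_orthogonal {n : ℕ} {a : EuclideanSpace ℝ (Fin n)} (ha : ‖a‖ = 1)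
    {f : EuclideanSpace ℝ (Fin n) → ℝ≥0∞} (hf : Measurable f) :
    ∫⁻ x, f x = ∫⁻ t : ℝ,
      ∫⁻ y : ((Submodule.span ℝ {a})ᗮ : Submodule ℝ (EuclideanSpace ℝ (Fin n))),
        f (t • a + y) := by
  have ha0 : a ≠ 0 := by rintro rfl; simp at ha
  let s := Submodule.span ℝ {a}
  have hmp := (s.measurePreserving_measurableEquivProd
    (0 : EuclideanSpace ℝ (Fin n))).symm
  rw [InnerProductSpace.euclideanHausdorffMeasure_eq_volume] at hmp
  rw [← hmp.lintegral_comp hf, Measure.volume_eq_prod, lintegral_prod _ (by fun_prop)]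
  let v : s := ⟨a, Submodule.mem_span_singleton_self a⟩
  have hv : v ≠ 0 := fun h => ha0 (congrArg Subtype.val h)
  have hvn : ‖v‖ₑ = 1 := by
    have h : ‖v‖ = 1 := ha
    rw [← ofReal_norm, h, ENNReal.ofReal_one]
  -- As `v` is a unit vector, the volume on the line is the image of Lebesgue measure under `t ↦ t •
  -- v`.
  rw [volume_eq_of_finrank_eq_one (finrank_span_singleton ha0) hv, hvn, one_smul]
  rw [lintegral_map]
  · simp [v, s]
  · simp only [Submodule.measurableEquivProd_symm_apply, vadd_eq_add, add_zero]
    refine Measurable.lintegral_prod_right' (f := fun q : s × sᗮ => f (q.1 + q.2)) ?_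
    fun_prop
  · fun_prop

/-! ### Gaussian integrals over hyperplanes. -/

/-- The Gaussian weight with coefficients `s`. -/
noncomputable def gaussianWeight {n : ℕ} (s : Fin n → ℝ) (x : EuclideanSpace ℝ (Fin n)) : ℝ≥0∞ :=
  ENNReal.ofReal (exp (-∑ j, s j * x j ^ 2))

@[fun_prop]
lemma measurable_gaussianWeight {n : ℕ} (s : Fin n → ℝ) : Measurable (gaussianWeight s) := by
  unfold gaussianWeight
  fun_prop

lemma lintegral_exp_neg_mul_sq {c : ℝ} (hc : 0 < c) :
    ∫⁻ t : ℝ, ENNReal.ofReal (exp (-c * t ^ 2)) = ENNReal.ofReal √(π / c) := by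
  rw [← integral_gaussian, ofReal_integral_eq_lintegral_ofReal (integrable_exp_neg_mul_sq hc)]
  exact Filter.Eventually.of_forall fun t => (exp_pos _).le

lemma sum_sq_div_pos {n : ℕ} {a : EuclideanSpace ℝ (Fin n)} (ha : a ≠ 0) {s : Fin n → ℝ}
    (hs : ∀ j, 0 < s j) : 0 < ∑ j, a j ^ 2 / s j := by
  obtain ⟨j, hj⟩ : ∃ j, a j ≠ 0 := by
    by_contra! h
    exact ha (by ext j; simpa using h j)
  exact Finset.sum_pos' (fun i _ => div_nonneg (sq_nonneg _) (hs i).le)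
    ⟨j, Finset.mem_univ _, div_pos (by positivity) (hs j)⟩

/-- The integral of a Gaussian weight over a hyperplane, in terms of its integral over the
space. -/
lemma lintegral_gaussianWeight_perp {n : ℕ} {a : EuclideanSpace ℝ (Fin n)} (ha : ‖a‖ = 1)
    {s : Fin n → ℝ} (hs : ∀ j, 0 < s j) :
    ∫⁻ x in perp a, gaussianWeight s x ∂μHE[n - 1] =
      (∫⁻ x, gaussianWeight s x) * ENNReal.ofReal (√(π * ∑ j, a j ^ 2 / s j))⁻¹ := by
  have ha0 : a ≠ 0 := by rintro rfl; simp at ha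
  have hS := sum_sq_div_pos ha0 hs
  set S := ∑ j, a j ^ 2 / s j with hSdef
  let H : Submodule ℝ (EuclideanSpace ℝ (Fin n)) := (Submodule.span ℝ {a})ᗮ
  -- The minimiser of `∑ s j * x j ^ 2` subject to `⟨x, a⟩ = 1`, with minimum `S⁻¹`. Shearing each
  -- slice by `t • (u - a)` removes the cross term, so the quadratic form splits.
  let u : EuclideanSpace ℝ (Fin n) := WithLp.toLp 2 fun j => a j / s j / S
  have haa : inner ℝ a a = 1 := by rw [real_inner_self_eq_norm_sq, ha]; norm_num
  have hua : inner ℝ u a = 1 := by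
    simp only [PiLp.inner_apply, RCLike.inner_apply, conj_trivial, u]
    rw [← div_self hS.ne', hSdef, Finset.sum_div]
    refine Finset.sum_congr rfl fun j _ => ?_
    ring
  have hw : u - a ∈ H := by
    rw [Submodule.mem_orthogonal_singleton_iff_inner_left, inner_sub_left, hua, haa, sub_self]
  let w : H := ⟨u - a, hw⟩
  have hQ : ∀ (t : ℝ) (y : H), gaussianWeight s (t • a + (t • w + y : H)) =
      ENNReal.ofReal (exp (-S⁻¹ * t ^ 2)) * gaussianWeight s y := by
    intro t y
    have hy : ∑ j, a j * (y : EuclideanSpace ℝ (Fin n)) j = 0 := by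
      have := (Submodule.mem_orthogonal_singleton_iff_inner_left).1 y.2
      simpa [PiLp.inner_apply] using this
    rw [gaussianWeight, gaussianWeight, ← ENNReal.ofReal_mul (exp_pos _).le, ← exp_add]
    congr 2
    have h1 : ∀ j, s j * ((t • a + (t • w + y : H) : EuclideanSpace ℝ (Fin n)) j) ^ 2 =
        t ^ 2 / S ^ 2 * (a j ^ 2 / s j) + 2 * t / S * (a j * (y : EuclideanSpace ℝ (Fin n)) j)
          + s j * (y : EuclideanSpace ℝ (Fin n)) j ^ 2 := by
      intro j
      have := (hs j).ne'
      have := hS.ne'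
      simp only [Submodule.coe_add, Submodule.coe_smul, PiLp.add_apply, PiLp.smul_apply, w, u,
        PiLp.sub_apply, smul_eq_mul]
      field_simp
      ring
    simp only [h1, Finset.sum_add_distrib, ← Finset.mul_sum, hy, ← hSdef]
    have := hS.ne'
    field_simp
    ring
  have hF : ∫⁻ x, gaussianWeight s x =
      ENNReal.ofReal √(π * S) * ∫⁻ y : H, gaussianWeight s y := by
    rw [lintegral_eq_lintegral_orthogonal ha (measurable_gaussianWeight s)]
    have : ∀ t : ℝ, ∫⁻ y : H, gaussianWeight s (t • a + y) =
        ENNReal.ofReal (exp (-S⁻¹ * t ^ 2)) * ∫⁻ y : H, gaussianWeight s y := by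
      intro t
      rw [← lintegral_add_left_eq_self _ (t • w)]
      simp_rw [hQ]
      exact lintegral_const_mul _ (by fun_prop)
    simp_rw [H] at this
    simp_rw [this]
    rw [lintegral_mul_const _ (by fun_prop), lintegral_exp_neg_mul_sq (inv_pos.2 hS),
      div_inv_eq_mul]
  have hpos : 0 < √(π * S) := sqrt_pos.2 (by positivity)
  rw [lintegral_restrict_perp ha0, hF, mul_right_comm, ← ENNReal.ofReal_mul hpos.le,
    mul_inv_cancel₀ hpos.ne', ENNReal.ofReal_one, one_mul]

/-- Supplies the integrable majorant for dominated convergence below. -/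
lemma lintegral_gaussianWeight_const_perp_lt_top {n : ℕ} {a : EuclideanSpace ℝ (Fin n)}
    (ha : a ≠ 0) {ε : ℝ} (hε : 0 < ε) :
    ∫⁻ x in perp a, gaussianWeight (fun _ => ε) x ∂μHE[n - 1] < ∞ := by
  rw [lintegral_restrict_perp ha]
  have h := (GaussianFourier.integrable_cexp_neg_mul_sq_norm_add (b := (ε : ℂ))
    (V := ((Submodule.span ℝ {a})ᗮ : Submodule ℝ (EuclideanSpace ℝ (Fin n))))
    (by simpa using hε) 0 0).norm.lintegral_lt_top
  refine lt_of_le_of_lt (le_of_eq (lintegral_congr fun y => ?_)) h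
  rw [gaussianWeight, Complex.norm_exp]
  congr 2
  rw [← Finset.mul_sum, ← EuclideanSpace.real_norm_sq_eq]
  simp [← Complex.ofReal_pow]

/-! ### Permuted normals and convexity. -/

/-- The rearrangement of the coordinates of a vector. -/
noncomputable def permVec {n : ℕ} (τ : Equiv.Perm (Fin n)) (b : EuclideanSpace ℝ (Fin n)) :
    EuclideanSpace ℝ (Fin n) :=
  LinearIsometryEquiv.piLpCongrLeft 2 ℝ ℝ τ.symm b

@[simp] lemma permVec_apply {n : ℕ} (τ : Equiv.Perm (Fin n)) (b : EuclideanSpace ℝ (Fin n))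
    (j : Fin n) : permVec τ b j = b (τ j) := by
  simp [permVec, LinearIsometryEquiv.piLpCongrLeft_apply, Equiv.piCongrLeft']

@[simp] lemma norm_permVec {n : ℕ} (τ : Equiv.Perm (Fin n)) (b : EuclideanSpace ℝ (Fin n)) :
    ‖permVec τ b‖ = ‖b‖ :=
  LinearIsometryEquiv.norm_map _ _

/-- Up to a constant this is the exponential of the convex function `-(1/2) * log x`. -/
lemma convexOn_inv_sqrt_mul {c : ℝ} (hc : 0 < c) :
    ConvexOn ℝ (Set.Ioi 0) fun x : ℝ => (√(c * x))⁻¹ := by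
  have hexp : ∀ x : ℝ, 0 < x → (√(c * x))⁻¹ = (√c)⁻¹ * exp (-(1 / 2) * log x) := by
    intro x hx
    rw [sqrt_mul hc.le, mul_inv, sqrt_eq_rpow x, ← rpow_neg hx.le, rpow_def_of_pos hx,
      mul_comm (log x)]
  refine ⟨convex_Ioi 0, fun x hx y hy u v hu hv huv => ?_⟩
  have hx : 0 < x := hx
  have hy : 0 < y := hy
  have hxy : 0 < u • x + v • y := (convex_Ioi (0 : ℝ)) hx hy hu hv huv
  have h1 := strictConcaveOn_log_Ioi.concaveOn.2 hx hy hu hv huv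
  have h2 := convexOn_exp.2 (Set.mem_univ (-(1 / 2) * log x)) (Set.mem_univ (-(1 / 2) * log y))
    hu hv huv
  simp only [smul_eq_mul] at *
  rw [hexp _ hxy, hexp _ hx, hexp _ hy, mul_left_comm u, mul_left_comm v, ← mul_add]
  gcongr
  refine le_trans (exp_le_exp.2 ?_) h2
  linarith

/-- Convexity of hyperplane integrals of Gaussian weights in the squared coordinates of the
normal vector. -/
lemma lintegral_gaussianWeight_perp_le {n : ℕ} {a b : EuclideanSpace ℝ (Fin n)} (ha : ‖a‖ = 1)
    (hb : ‖b‖ = 1) {w : Equiv.Perm (Fin n) → ℝ} (hw0 : ∀ τ, 0 ≤ w τ) (hw1 : ∑ τ, w τ = 1)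
    (hab : ∀ i, a i ^ 2 = ∑ τ, w τ * b (τ i) ^ 2) {s : Fin n → ℝ} (hs : ∀ j, 0 < s j) :
    ∫⁻ x in perp a, gaussianWeight s x ∂μHE[n - 1] ≤
      ∑ τ, ENNReal.ofReal (w τ) *
        ∫⁻ x in perp (permVec τ b), gaussianWeight s x ∂μHE[n - 1] := by
  have hbτ : ∀ τ, ‖permVec τ b‖ = 1 := fun τ => (norm_permVec τ b).trans hb
  have hne : ∀ τ, permVec τ b ≠ 0 := fun τ h => by simpa [h] using hbτ τ
  rw [lintegral_gaussianWeight_perp ha hs]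
  simp_rw [fun τ => lintegral_gaussianWeight_perp (hbτ τ) hs]
  simp_rw [mul_left_comm (ENNReal.ofReal (w _)), ← Finset.mul_sum]
  gcongr
  simp_rw [← ENNReal.ofReal_mul (hw0 _)]
  rw [← ENNReal.ofReal_sum_of_nonneg fun τ _ => mul_nonneg (hw0 τ) (by positivity)]
  refine ENNReal.ofReal_le_ofReal ?_
  have hcomb : ∑ j, a j ^ 2 / s j = ∑ τ, w τ • ∑ j, (permVec τ b) j ^ 2 / s j := by
    simp_rw [hab, smul_eq_mul, permVec_apply, Finset.mul_sum, Finset.sum_div]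
    rw [Finset.sum_comm]
    simp_rw [mul_div_assoc]
  rw [hcomb]
  exact (convexOn_inv_sqrt_mul pi_pos).map_sum_le (fun τ _ => hw0 τ) hw1
    fun τ _ => sum_sq_div_pos (hne τ) hs

/-! ### Functions whose multiplication preserves Gaussian comparison. -/

/-- `G` has smaller integral against `ν` than against `ν'`, also after multiplication by any
nondegenerate Gaussian weight. -/
def GaussianDominated {n : ℕ} (ν ν' : Measure (EuclideanSpace ℝ (Fin n)))
    (G : EuclideanSpace ℝ (Fin n) → ℝ≥0∞) : Prop :=
  Measurable G ∧ ∀ s : Fin n → ℝ, (∀ j, 0 < s j) →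
    ∫⁻ x, G x * gaussianWeight s x ∂ν ≤ ∫⁻ x, G x * gaussianWeight s x ∂ν'

/-- Multiplication by `F` preserves `GaussianDominated ν ν'`. -/
def GaussianMultiplier {n : ℕ} (ν ν' : Measure (EuclideanSpace ℝ (Fin n)))
    (F : EuclideanSpace ℝ (Fin n) → ℝ≥0∞) : Prop :=
  Measurable F ∧ ∀ G, GaussianDominated ν ν' G → GaussianDominated ν ν' fun x => F x * G x

namespace GaussianMultiplier

variable {n : ℕ} {ν ν' : Measure (EuclideanSpace ℝ (Fin n))}
  {F F₁ F₂ : EuclideanSpace ℝ (Fin n) → ℝ≥0∞}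

/-- Multipliers compose; this stability under products is the reason for working with multipliers
rather than with domination alone. -/
lemma mul (h₁ : GaussianMultiplier ν ν' F₁) (h₂ : GaussianMultiplier ν ν' F₂) :
    GaussianMultiplier ν ν' fun x => F₁ x * F₂ x := by
  refine ⟨h₁.1.mul h₂.1, fun G hG => ?_⟩
  simpa only [mul_assoc] using h₁.2 _ (h₂.2 _ hG)

lemma const (c : ℝ≥0∞) : GaussianMultiplier ν ν' fun _ => c := by
  refine ⟨measurable_const, fun G hG => ⟨hG.1.const_mul c, fun s hs => ?_⟩⟩
  have hm : Measurable fun x => G x * gaussianWeight s x :=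
    hG.1.mul (measurable_gaussianWeight s)
  simp_rw [mul_assoc]
  rw [lintegral_const_mul _ hm, lintegral_const_mul _ hm]
  exact mul_le_mul_right (hG.2 s hs) c

lemma pow (h : GaussianMultiplier ν ν' F) (m : ℕ) :
    GaussianMultiplier ν ν' fun x => F x ^ m := by
  induction m with
  | zero => simpa using const 1
  | succ m ih => simpa only [pow_succ] using ih.mul h

/-- Gaussian weights multiply by adding coefficients. Zero entries of `s` are allowed because the
test weight `r` is positive; this covers Gaussians in a single coordinate. -/
lemma gaussianWeight {s : Fin n → ℝ} (hs : ∀ j, 0 ≤ s j) :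
    GaussianMultiplier ν ν' (gaussianWeight s) := by
  refine ⟨measurable_gaussianWeight s,
    fun G hG => ⟨(measurable_gaussianWeight s).mul hG.1, fun r hr => ?_⟩⟩
  have hmul : ∀ x, _root_.gaussianWeight s x * G x * _root_.gaussianWeight r x =
      G x * _root_.gaussianWeight (s + r) x := by
    intro x
    rw [mul_comm (_root_.gaussianWeight s x), mul_assoc]
    congr 1
    simp only [_root_.gaussianWeight, ← ENNReal.ofReal_mul (exp_pos _).le, ← exp_add]
    simp only [Pi.add_apply, add_mul, Finset.sum_add_distrib, neg_add]
  simp_rw [hmul]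
  exact hG.2 _ fun j => add_pos_of_nonneg_of_pos (hs j) (hr j)

lemma lintegral [SFinite ν] [SFinite ν'] {α : Type*} [MeasurableSpace α] {ρ : Measure α}
    [SFinite ρ] {F : α → EuclideanSpace ℝ (Fin n) → ℝ≥0∞} (hF : Measurable (Function.uncurry F))
    (h : ∀ᵐ t ∂ρ, GaussianMultiplier ν ν' (F t)) :
    GaussianMultiplier ν ν' fun x => ∫⁻ t, F t x ∂ρ := by
  have hm : Measurable fun x => ∫⁻ t, F t x ∂ρ := hF.lintegral_prod_left'
  refine ⟨hm, fun G hG => ⟨hm.mul hG.1, fun s hs => ?_⟩⟩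
  have hswap : ∀ (μ : Measure (EuclideanSpace ℝ (Fin n))) [SFinite μ],
      ∫⁻ x, (∫⁻ t, F t x ∂ρ) * G x * _root_.gaussianWeight s x ∂μ =
        ∫⁻ t, ∫⁻ x, F t x * G x * _root_.gaussianWeight s x ∂μ ∂ρ := by
    intro μ _
    have hGm := hG.1
    rw [lintegral_lintegral_swap]
    · refine lintegral_congr fun x => ?_
      have h1 : Measurable fun t => F t x := hF.of_uncurry_right
      simp_rw [mul_assoc]
      rw [lintegral_mul_const _ h1]
    · refine Measurable.aemeasurable ?_
      refine ((hF.mul (hGm.comp measurable_snd)).mul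
        ((measurable_gaussianWeight s).comp measurable_snd))
  rw [hswap ν, hswap ν']
  refine lintegral_mono_ae ?_
  filter_upwards [h] with t ht
  exact (ht.2 G hG).2 s hs

lemma tsum {ι : Type*} [Countable ι] {F : ι → EuclideanSpace ℝ (Fin n) → ℝ≥0∞}
    (h : ∀ i, GaussianMultiplier ν ν' (F i)) :
    GaussianMultiplier ν ν' fun x => ∑' i, F i x := by
  have hm : Measurable fun x => ∑' i, F i x := Measurable.tsum fun i => (h i).1
  refine ⟨hm, fun G hG => ⟨hm.mul hG.1, fun s hs => ?_⟩⟩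
  simp_rw [← ENNReal.tsum_mul_right]
  have hm' : ∀ i, Measurable fun x => F i x * G x * _root_.gaussianWeight s x :=
    fun i => ((h i).1.mul hG.1).mul (measurable_gaussianWeight s)
  rw [lintegral_tsum fun i => (hm' i).aemeasurable, lintegral_tsum fun i => (hm' i).aemeasurable]
  exact ENNReal.tsum_le_tsum fun i => ((h i).2 G hG).2 s hs

lemma sum {ι : Type*} [Fintype ι] {F : ι → EuclideanSpace ℝ (Fin n) → ℝ≥0∞}
    (h : ∀ i, GaussianMultiplier ν ν' (F i)) :
    GaussianMultiplier ν ν' fun x => ∑ i, F i x := by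
  simpa only [tsum_fintype] using tsum h

/-- The exponential series has nonnegative coefficients. -/
lemma exp {g : EuclideanSpace ℝ (Fin n) → ℝ} (hg0 : ∀ x, 0 ≤ g x)
    (hg : GaussianMultiplier ν ν' fun x => ENNReal.ofReal (g x)) :
    GaussianMultiplier ν ν' fun x => ENNReal.ofReal (Real.exp (g x)) := by
  have hexp : ∀ x, ENNReal.ofReal (Real.exp (g x)) =
      ∑' m : ℕ, ENNReal.ofReal (m.factorial : ℝ)⁻¹ * ENNReal.ofReal (g x) ^ m := by
    intro x
    have hs := NormedSpace.expSeries_div_hasSum_exp (g x)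
    rw [← Real.exp_eq_exp_ℝ] at hs
    rw [← hs.tsum_eq, ENNReal.ofReal_tsum_of_nonneg
      (fun m => div_nonneg (pow_nonneg (hg0 x) m) (by positivity)) hs.summable]
    refine tsum_congr fun m => ?_
    rw [div_eq_inv_mul, ENNReal.ofReal_mul (by positivity), ENNReal.ofReal_pow (hg0 x)]
  simp_rw [hexp]
  exact tsum fun m => (const _).mul (hg.pow m)

end GaussianMultiplier

/-! ### Lévy–Khintchine representation of `l ↦ l ^ α`. -/

section Stable

variable {α : ℝ}

/-- Near `0` the bound `1 - exp (-(l * t)) ≤ l * t` leaves `t ^ (-α)`, integrable as `α < 1`; at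
infinity `t ^ (-1 - α)` is integrable as `α > 0`. -/
lemma integrableOn_one_sub_exp_mul_rpow (hα0 : 0 < α) (hα1 : α < 1) {l : ℝ} (hl : 0 ≤ l) :
    IntegrableOn (fun t : ℝ => (1 - exp (-(l * t))) * t ^ (-1 - α)) (Set.Ioi 0) := by
  have hmeas : Measurable fun t : ℝ => (1 - exp (-(l * t))) * t ^ (-1 - α) := by fun_prop
  rw [← Set.Ioc_union_Ioi_eq_Ioi zero_le_one]
  refine IntegrableOn.union ?_ ?_
  · have h1 : IntegrableOn (fun t : ℝ => l * t ^ (-α)) (Set.Ioc 0 1) := by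
      rw [← intervalIntegrable_iff_integrableOn_Ioc_of_le zero_le_one]
      exact (intervalIntegral.intervalIntegrable_rpow' (by linarith)).const_mul l
    refine h1.mono' hmeas.aestronglyMeasurable ?_
    refine (ae_restrict_iff' measurableSet_Ioc).2 (Eventually.of_forall fun t ht => ?_)
    have ht0 : 0 < t := ht.1
    have h2 : 1 - exp (-(l * t)) ≤ l * t := by linarith [add_one_le_exp (-(l * t))]
    have h3 : 0 ≤ 1 - exp (-(l * t)) := by
      have : exp (-(l * t)) ≤ 1 := exp_le_one_iff.2 (by nlinarith)
      linarith
    rw [norm_of_nonneg (by positivity)]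
    calc (1 - exp (-(l * t))) * t ^ (-1 - α) ≤ l * t * t ^ (-1 - α) := by gcongr
      _ = l * t ^ (-α) := by
        rw [mul_assoc, ← rpow_one_add' ht0.le (by linarith)]
        congr 2
        ring
  · refine (integrableOn_Ioi_rpow_of_lt (a := -1 - α) (by linarith) zero_lt_one).mono'
      hmeas.aestronglyMeasurable ?_
    refine (ae_restrict_iff' measurableSet_Ioi).2 (Eventually.of_forall fun t ht => ?_)
    have ht0 : (0 : ℝ) < t := lt_trans zero_lt_one ht
    have h3 : 0 ≤ 1 - exp (-(l * t)) := by
      have : exp (-(l * t)) ≤ 1 := exp_le_one_iff.2 (by nlinarith)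
      linarith
    rw [norm_of_nonneg (by positivity)]
    refine mul_le_of_le_one_left (by positivity) ?_
    linarith [exp_pos (-(l * t))]

/-- The normalising constant in the Lévy–Khintchine representation of `l ↦ l ^ α`. -/
noncomputable def levyConst (α : ℝ) : ℝ :=
  ∫ t in Set.Ioi (0 : ℝ), (1 - exp (-t)) * t ^ (-1 - α)

lemma levyConst_pos (hα0 : 0 < α) (hα1 : α < 1) : 0 < levyConst α := by
  have hint := integrableOn_one_sub_exp_mul_rpow hα0 hα1 zero_le_one
  simp only [one_mul] at hint
  have hpos : ∀ t ∈ Set.Ioi (0 : ℝ), 0 < (1 - exp (-t)) * t ^ (-1 - α) := fun t ht => by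
    have ht : 0 < t := ht
    have : exp (-t) < 1 := exp_lt_one_iff.2 (by linarith)
    exact mul_pos (by linarith) (by positivity)
  refine (setIntegral_pos_iff_support_of_nonneg_ae
    ((ae_restrict_iff' measurableSet_Ioi).2 (Eventually.of_forall fun t ht => (hpos t ht).le))
    hint).2 ?_
  have hsub : Set.Ioi (0 : ℝ) ⊆ Function.support fun t : ℝ => (1 - exp (-t)) * t ^ (-1 - α) :=
    fun t ht => (hpos t ht).ne'
  rw [Set.inter_eq_right.2 hsub]
  simp

lemma integral_one_sub_exp_mul_rpow (hα0 : 0 < α) {l : ℝ} (hl : 0 ≤ l) :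
    ∫ t in Set.Ioi (0 : ℝ), (1 - exp (-(l * t))) * t ^ (-1 - α) = levyConst α * l ^ α := by
  rcases hl.eq_or_lt with rfl | hl
  · simp [zero_rpow hα0.ne']
  have h := integral_comp_mul_left_Ioi (fun t : ℝ => (1 - exp (-t)) * t ^ (-1 - α)) 0 hl
  rw [mul_zero, smul_eq_mul] at h
  have h2 : ∫ t in Set.Ioi (0 : ℝ), (1 - exp (-(l * t))) * t ^ (-1 - α) =
      l ^ (1 + α) * ∫ t in Set.Ioi (0 : ℝ), (1 - exp (-(l * t))) * (l * t) ^ (-1 - α) := by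
    rw [← integral_const_mul]
    refine setIntegral_congr_fun measurableSet_Ioi fun t ht => ?_
    have ht : 0 < t := ht
    rw [mul_rpow hl.le ht.le, show -1 - α = -(1 + α) by ring, rpow_neg hl.le]
    have := (rpow_pos_of_pos hl (1 + α)).ne'
    field_simp
  rw [h2, h, rpow_add hl, rpow_one, levyConst]
  field_simp

/-- The truncated Lévy–Khintchine exponents of `l ↦ l ^ α`. -/
noncomputable def truncatedExponent (α δ l : ℝ) : ℝ :=
  (levyConst α)⁻¹ * ∫ t in Set.Ioi δ, (1 - exp (-(l * t))) * t ^ (-1 - α)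

lemma tendsto_truncatedExponent (hα0 : 0 < α) (hα1 : α < 1) {l : ℝ} (hl : 0 ≤ l) :
    Tendsto (fun k : ℕ => truncatedExponent α (1 / ((k : ℝ) + 1)) l) atTop (𝓝 (l ^ α)) := by
  have hU : ⋃ k : ℕ, Set.Ioi (1 / ((k : ℝ) + 1)) = Set.Ioi 0 := by
    ext t
    simp only [Set.mem_iUnion, Set.mem_Ioi]
    refine ⟨fun ⟨k, hk⟩ => lt_trans (by positivity) hk, fun ht => exists_nat_one_div_lt ht⟩
  have h := tendsto_setIntegral_of_monotone (μ := volume)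
    (f := fun t : ℝ => (1 - exp (-(l * t))) * t ^ (-1 - α))
    (s := fun k : ℕ => Set.Ioi (1 / ((k : ℝ) + 1))) (fun k => measurableSet_Ioi)
    (fun i j hij => Set.Ioi_subset_Ioi (one_div_le_one_div_of_le (by positivity) (by gcongr)))
    (by rw [hU]; exact integrableOn_one_sub_exp_mul_rpow hα0 hα1 hl)
  rw [hU, integral_one_sub_exp_mul_rpow hα0 hl] at h
  have := h.const_mul (levyConst α)⁻¹
  rwa [inv_mul_cancel_left₀ (levyConst_pos hα0 hα1).ne'] at this

lemma truncatedExponent_nonneg (hα0 : 0 < α) (hα1 : α < 1) {δ l : ℝ} (hδ : 0 < δ) (hl : 0 ≤ l) :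
    0 ≤ truncatedExponent α δ l := by
  refine mul_nonneg (inv_nonneg.2 (levyConst_pos hα0 hα1).le)
    (setIntegral_nonneg measurableSet_Ioi fun t ht => ?_)
  have ht : 0 < t := hδ.trans ht
  have : exp (-(l * t)) ≤ 1 := exp_le_one_iff.2 (by nlinarith)
  exact mul_nonneg (by linarith) (by positivity)

lemma integrableOn_exp_mul_rpow (hα0 : 0 < α) {δ l : ℝ} (hδ : 0 < δ) (hl : 0 ≤ l) :
    IntegrableOn (fun t : ℝ => exp (-(l * t)) * t ^ (-1 - α)) (Set.Ioi δ) := by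
  have hmeas : Measurable fun t : ℝ => exp (-(l * t)) * t ^ (-1 - α) := by fun_prop
  refine (integrableOn_Ioi_rpow_of_lt (a := -1 - α) (by linarith) hδ).mono'
    hmeas.aestronglyMeasurable ?_
  refine (ae_restrict_iff' measurableSet_Ioi).2 (Eventually.of_forall fun t ht => ?_)
  have ht0 : (0 : ℝ) < t := hδ.trans ht
  rw [norm_of_nonneg (by positivity)]
  exact mul_le_of_le_one_left (by positivity) (exp_le_one_iff.2 (by nlinarith))

lemma gaussianWeight_single {n : ℕ} (j : Fin n) (t : ℝ) (x : EuclideanSpace ℝ (Fin n)) :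
    gaussianWeight (Pi.single j t) x = ENNReal.ofReal (exp (-(x j ^ 2 * t))) := by
  rw [gaussianWeight, Finset.sum_eq_single j]
  · simp [mul_comm]
  · intro i _ hi
    simp [hi]
  · simp

/-- Away from `t = 0` the Lévy density is integrable, so the exponent is a constant minus a positive
mixture of the functions `exp (-(l * t))`. At `l = x j ^ 2` these are Gaussians, and the minus sign
in front turns the mixture into the exponential of a multiplier. -/
lemma GaussianMultiplier.exp_neg_truncatedExponent {n : ℕ}
    {ν ν' : Measure (EuclideanSpace ℝ (Fin n))} [SFinite ν] [SFinite ν'] (hα0 : 0 < α)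
    (hα1 : α < 1) {δ : ℝ} (hδ : 0 < δ) :
    GaussianMultiplier ν ν' fun x =>
      ENNReal.ofReal (Real.exp (-∑ j, truncatedExponent α δ (x j ^ 2))) := by
  set c := (levyConst α)⁻¹ with hc
  have hc0 : 0 ≤ c := inv_nonneg.2 (levyConst_pos hα0 hα1).le
  let I : ℝ → ℝ := fun l => ∫ t in Set.Ioi δ, Real.exp (-(l * t)) * t ^ (-1 - α)
  have hI0 : ∀ l, 0 ≤ I l := fun l => setIntegral_nonneg measurableSet_Ioi fun t ht => by
    have ht : 0 < t := hδ.trans ht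
    positivity
  have hψ : ∀ l, 0 ≤ l → truncatedExponent α δ l = c * I 0 - c * I l := by
    intro l hl
    rw [← mul_sub, ← integral_sub (integrableOn_exp_mul_rpow hα0 hδ le_rfl)
      (integrableOn_exp_mul_rpow hα0 hδ hl), truncatedExponent]
    simp [sub_mul, hc]
  have heq : ∀ x : EuclideanSpace ℝ (Fin n),
      ENNReal.ofReal (Real.exp (-∑ j, truncatedExponent α δ (x j ^ 2))) =
        ENNReal.ofReal (Real.exp (-(n * (c * I 0)))) *
          ENNReal.ofReal (Real.exp (∑ j, c * I (x j ^ 2))) := by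
    intro x
    rw [← ENNReal.ofReal_mul (exp_pos _).le, ← exp_add]
    simp_rw [hψ _ (sq_nonneg _), Finset.sum_sub_distrib]
    simp
    ring_nf
  simp_rw [heq]
  refine (const _).mul (GaussianMultiplier.exp
    (fun x => Finset.sum_nonneg fun j _ => mul_nonneg hc0 (hI0 _)) ?_)
  have hsum : ∀ x : EuclideanSpace ℝ (Fin n), ENNReal.ofReal (∑ j, c * I (x j ^ 2)) =
      ∑ j, ENNReal.ofReal c * ∫⁻ t in Set.Ioi δ,
        ENNReal.ofReal (Real.exp (-(x j ^ 2 * t))) * ENNReal.ofReal (t ^ (-1 - α)) := by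
    intro x
    rw [ENNReal.ofReal_sum_of_nonneg fun j _ => mul_nonneg hc0 (hI0 _)]
    refine Finset.sum_congr rfl fun j _ => ?_
    rw [ENNReal.ofReal_mul hc0, ofReal_integral_eq_lintegral_ofReal
      (integrableOn_exp_mul_rpow hα0 hδ (sq_nonneg _))]
    · simp_rw [ENNReal.ofReal_mul (exp_pos _).le]
    · refine (ae_restrict_iff' measurableSet_Ioi).2 (Eventually.of_forall fun t ht => ?_)
      have ht : 0 < t := hδ.trans ht
      simp only [Pi.zero_apply]
      positivity
  simp_rw [hsum]
  refine GaussianMultiplier.sum fun j => (const _).mul (GaussianMultiplier.lintegral ?_ ?_)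
  · unfold Function.uncurry
    fun_prop
  · refine (ae_restrict_iff' measurableSet_Ioi).2 (Eventually.of_forall fun t ht => ?_)
    have ht : 0 < t := hδ.trans ht
    simp_rw [← gaussianWeight_single]
    refine (GaussianMultiplier.gaussianWeight fun i => ?_).mul (const _)
    by_cases h : i = j
    · subst h; simpa using ht.le
    · simp [h]

end Stable

/-! ### Removing the truncation. -/

/-- If all nondegenerate Gaussian weights have smaller integral against `ν` than against `ν'`, then
so does `exp (-∑ |x j| ^ p)` for `0 < p < 2`. -/
theorem lintegral_exp_neg_sum_abs_rpow_le {n : ℕ} {ν ν' : Measure (EuclideanSpace ℝ (Fin n))}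
    [SFinite ν] [SFinite ν'] {p : ℝ} (hp0 : 0 < p) (hp2 : p < 2)
    (hle : ∀ s : Fin n → ℝ, (∀ j, 0 < s j) →
      ∫⁻ x, gaussianWeight s x ∂ν ≤ ∫⁻ x, gaussianWeight s x ∂ν')
    (hν : ∀ ε : ℝ, 0 < ε → ∫⁻ x, gaussianWeight (fun _ => ε) x ∂ν ≠ ∞)
    (hν' : ∀ ε : ℝ, 0 < ε → ∫⁻ x, gaussianWeight (fun _ => ε) x ∂ν' ≠ ∞) :
    ∫⁻ x, ENNReal.ofReal (exp (-∑ j, |x j| ^ p)) ∂ν ≤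
      ∫⁻ x, ENNReal.ofReal (exp (-∑ j, |x j| ^ p)) ∂ν' := by
  have hα0 : 0 < p / 2 := by linarith
  have hα1 : p / 2 < 1 := by linarith
  set N : EuclideanSpace ℝ (Fin n) → ℝ≥0∞ :=
    fun x => ENNReal.ofReal (exp (-∑ j, |x j| ^ p)) with hN
  have hNm : Measurable N := by fun_prop
  have hone : GaussianDominated ν ν' fun _ => 1 :=
    ⟨measurable_const, fun s hs => by simpa using hle s hs⟩
  let T : ℕ → EuclideanSpace ℝ (Fin n) → ℝ≥0∞ := fun k x =>
    ENNReal.ofReal (exp (-∑ j, truncatedExponent (p / 2) (1 / ((k : ℝ) + 1)) (x j ^ 2)))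
  have hT : ∀ k, GaussianMultiplier ν ν' (T k) := fun k =>
    GaussianMultiplier.exp_neg_truncatedExponent hα0 hα1 (by positivity)
  have hT1 : ∀ k x, T k x ≤ 1 := fun k x => by
    rw [ENNReal.ofReal_le_one, exp_le_one_iff, neg_nonpos]
    exact Finset.sum_nonneg fun j _ =>
      truncatedExponent_nonneg hα0 hα1 (by positivity) (sq_nonneg _)
  have hTN : ∀ x, Tendsto (fun k => T k x) atTop (𝓝 (N x)) := by
    intro x
    refine (ENNReal.continuous_ofReal.tendsto _).comp ((continuous_exp.tendsto _).comp
      (Tendsto.neg (tendsto_finsetSum _ fun j _ => ?_)))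
    have h := tendsto_truncatedExponent hα0 hα1 (sq_nonneg (x j))
    have habs : (x j ^ 2) ^ (p / 2) = |x j| ^ p := by
      rw [← sq_abs, ← rpow_natCast, ← rpow_mul (abs_nonneg _)]
      congr 1
      push_cast
      ring
    rwa [habs] at h
  -- The extra weight `ε` is both the test weight required by `GaussianDominated` and the majorant,
  -- since `T k ≤ 1`. It is removed afterwards by monotone convergence as `ε` decreases to `0`.
  have hlim : ∀ ε : ℝ, 0 < ε → ∀ μ : Measure (EuclideanSpace ℝ (Fin n)),
      ∫⁻ x, gaussianWeight (fun _ => ε) x ∂μ ≠ ∞ →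
      Tendsto (fun k => ∫⁻ x, T k x * gaussianWeight (fun _ => ε) x ∂μ) atTop
        (𝓝 (∫⁻ x, N x * gaussianWeight (fun _ => ε) x ∂μ)) := by
    intro ε hε μ hμ
    refine tendsto_lintegral_of_dominated_convergence (gaussianWeight fun _ => ε)
      (fun k => (hT k).1.mul (measurable_gaussianWeight _))
      (fun k => Eventually.of_forall fun x => mul_le_of_le_one_left' (hT1 k x)) hμ
      (Eventually.of_forall fun x => ?_)
    exact ENNReal.Tendsto.mul_const (hTN x) (Or.inr ENNReal.ofReal_ne_top)
  have hreg : ∀ ε : ℝ, 0 < ε → ∫⁻ x, N x * gaussianWeight (fun _ => ε) x ∂ν ≤ ∫⁻ x, N x ∂ν' := by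
    intro ε hε
    refine (le_of_tendsto_of_tendsto' (hlim ε hε ν (hν ε hε)) (hlim ε hε ν' (hν' ε hε))
      fun k => ?_).trans (lintegral_mono fun x => mul_le_of_le_one_right' ?_)
    · simpa using ((hT k).2 _ hone).2 (fun _ => ε) fun _ => hε
    · rw [gaussianWeight, ENNReal.ofReal_le_one, exp_le_one_iff, neg_nonpos]
      positivity
  refine le_of_tendsto' (lintegral_tendsto_of_tendsto_of_monotone
    (f := fun (k : ℕ) x => N x * gaussianWeight (fun _ => 1 / ((k : ℝ) + 1)) x)
    (fun k => (hNm.mul (measurable_gaussianWeight _)).aemeasurable)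
    (Eventually.of_forall fun x i j hij => ?_) (Eventually.of_forall fun x => ?_))
    fun k => hreg (1 / ((k : ℝ) + 1)) (by positivity)
  · dsimp only
    unfold gaussianWeight
    have h := one_div_le_one_div_of_le (a := (i : ℝ) + 1) (b := (j : ℝ) + 1) (by positivity)
      (by gcongr)
    gcongr
  · have h0 : Tendsto (fun k : ℕ => gaussianWeight (fun _ => 1 / ((k : ℝ) + 1)) x) atTop (𝓝 1) := by
      unfold gaussianWeight
      simp_rw [← Finset.mul_sum]
      have := (tendsto_one_div_add_atTop_nhds_zero_nat (𝕜 := ℝ)).mul_const (∑ j, x j ^ 2)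
      rw [zero_mul] at this
      have := (ENNReal.continuous_ofReal.tendsto _).comp ((continuous_exp.tendsto _).comp this.neg)
      simpa [Function.comp_def] using this
    simpa using ENNReal.Tendsto.const_mul h0 (Or.inr ENNReal.ofReal_ne_top)

/-! ### From exponential integrals to volumes of sections. -/

lemma mem_ellBall_iff {n : ℕ} {p : ℝ} (hp : 0 < p) (x : EuclideanSpace ℝ (Fin n)) :
    x ∈ ellBall n p ↔ ∑ j, |x j| ^ p ≤ 1 := by
  have h0 : 0 ≤ ∑ j, |x j| ^ p := Finset.sum_nonneg fun j _ => by positivity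
  rw [ellBall, Set.mem_ofPred_eq, ellNorm]
  simpa only [one_rpow] using rpow_le_rpow_iff h0 zero_le_one (one_div_pos.2 hp)

lemma smul_mem_perp_iff {n : ℕ} {a x : EuclideanSpace ℝ (Fin n)} {c : ℝ} (hc : c ≠ 0) :
    c • x ∈ perp a ↔ x ∈ perp a := by
  simp [perp, real_inner_smul_left, hc]

lemma sublevel_inter_perp_eq_smul {n : ℕ} {p : ℝ} (hp : 0 < p) (a : EuclideanSpace ℝ (Fin n))
    {u : ℝ} (hu : 0 < u) :
    {x : EuclideanSpace ℝ (Fin n) | ∑ j, |x j| ^ p ≤ u} ∩ perp a =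
      u ^ (1 / p) • (ellBall n p ∩ perp a) := by
  have hc : 0 < u ^ (1 / p) := rpow_pos_of_pos hu _
  have hcp : (u ^ (1 / p)) ^ p = u := by
    rw [← rpow_mul hu.le, one_div_mul_cancel hp.ne', rpow_one]
  ext x
  rw [Set.mem_smul_set_iff_inv_smul_mem₀ hc.ne', Set.mem_inter_iff, Set.mem_inter_iff,
    smul_mem_perp_iff (inv_ne_zero hc.ne'), mem_ellBall_iff hp]
  refine and_congr_left fun _ => ?_
  simp only [PiLp.smul_apply, smul_eq_mul, abs_mul, abs_inv, abs_of_pos hc]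
  simp_rw [mul_rpow (inv_nonneg.2 hc.le) (abs_nonneg _), inv_rpow hc.le, hcp, ← Finset.mul_sum]
  rw [inv_mul_le_iff₀ hu, mul_one, Set.mem_ofPred_eq]

/-- The factor between the integral of `exp (-∑ |x j| ^ p)` over a `d`-dimensional section and the
volume of the section of the unit ball. -/
noncomputable def sectionFactor (d : ℕ) (p : ℝ) : ℝ≥0∞ :=
  ∫⁻ u in Set.Ioi (0 : ℝ), ENNReal.ofReal (exp (-u) * (u ^ (1 / p)) ^ d)

lemma sectionFactor_ne_zero (d : ℕ) (p : ℝ) : sectionFactor d p ≠ 0 := by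
  refine (setLIntegral_pos_iff (by fun_prop)).2 ?_ |>.ne'
  have hsub : Set.Ioi (0 : ℝ) ⊆ Function.support fun u : ℝ =>
      ENNReal.ofReal (exp (-u) * (u ^ (1 / p)) ^ d) := fun u hu => by
    have hu : 0 < u := hu
    rw [Function.mem_support, Ne, ENNReal.ofReal_eq_zero, not_le]
    positivity
  rw [Set.inter_eq_right.2 hsub]
  simp

lemma sectionFactor_ne_top (d : ℕ) {p : ℝ} (hp : 0 < p) : sectionFactor d p ≠ ∞ := by
  -- The factor is the Gamma integral at `d / p + 1`.
  have h := (GammaIntegral_convergent (s := 1 / p * d + 1) (by positivity))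
  have h2 : IntegrableOn (fun u : ℝ => exp (-u) * (u ^ (1 / p)) ^ d) (Set.Ioi 0) := by
    refine h.congr_fun (fun u hu => ?_) measurableSet_Ioi
    have hu : 0 < u := hu
    rw [← rpow_natCast, ← rpow_mul hu.le, add_sub_cancel_right]
  exact h2.lintegral_lt_top.ne

/-- The closed ray makes the layers the closed sublevel sets `∑ |x j| ^ p ≤ u`, which are dilates of
the ball. -/
lemma ofReal_exp_neg_eq_setLIntegral {r : ℝ} (hr : 0 ≤ r) :
    ENNReal.ofReal (exp (-r)) =
      ∫⁻ u in Set.Ioi (0 : ℝ), (Set.Ici r).indicator (fun u => ENNReal.ofReal (exp (-u))) u := by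
  rw [lintegral_indicator measurableSet_Ici, Measure.restrict_restrict measurableSet_Ici,
    ← integral_exp_neg_Ioi, ofReal_integral_eq_lintegral_ofReal (integrableOn_exp_neg_Ioi r)
      (Eventually.of_forall fun u => (exp_pos _).le)]
  rw [← setLIntegral_congr (Ioi_ae_eq_Ici.inter (ae_eq_refl (Set.Ioi (0 : ℝ)))),
    Set.inter_eq_left.2 (Set.Ioi_subset_Ioi hr)]

/-- The layer-cake formula for `exp (-∑ |x j| ^ p)` on a hyperplane. -/
lemma lintegral_exp_neg_perp {n : ℕ} {p : ℝ} (hp : 0 < p) {a : EuclideanSpace ℝ (Fin n)}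
    (ha : a ≠ 0) :
    ∫⁻ x in perp a, ENNReal.ofReal (exp (-∑ j, |x j| ^ p)) ∂μHE[n - 1] =
      sectionFactor (n - 1) p * μHE[n - 1] (ellBall n p ∩ perp a) := by
  have := sFinite_restrict_perp ha
  have hN : Measurable fun x : EuclideanSpace ℝ (Fin n) => ∑ j, |x j| ^ p := by fun_prop
  have h0 : ∀ x : EuclideanSpace ℝ (Fin n), 0 ≤ ∑ j, |x j| ^ p :=
    fun x => Finset.sum_nonneg fun j _ => by positivity
  simp_rw [fun x => ofReal_exp_neg_eq_setLIntegral (h0 x)]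
  rw [lintegral_lintegral_swap]
  · rw [sectionFactor, ← lintegral_mul_const _ (by fun_prop)]
    refine setLIntegral_congr_fun measurableSet_Ioi fun u hu => ?_
    have hu : 0 < u := hu
    have hind : ∀ x : EuclideanSpace ℝ (Fin n),
        (Set.Ici (∑ j, |x j| ^ p)).indicator (fun u => ENNReal.ofReal (exp (-u))) u =
          {x : EuclideanSpace ℝ (Fin n) | ∑ j, |x j| ^ p ≤ u}.indicator
            (fun _ => ENNReal.ofReal (exp (-u))) x := fun x => by
      simp [Set.indicator_apply]
    have hms : MeasurableSet {x : EuclideanSpace ℝ (Fin n) | ∑ j, |x j| ^ p ≤ u} :=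
      measurableSet_le hN measurable_const
    have hc : 0 < u ^ (1 / p) := rpow_pos_of_pos hu _
    simp_rw [hind]
    rw [lintegral_indicator_const hms, Measure.restrict_apply hms,
      sublevel_inter_perp_eq_smul hp a hu, Measure.euclideanHausdorffMeasure_smul₀ _ hc.ne',
      ENNReal.ofReal_mul (exp_pos _).le, ENNReal.smul_def, smul_eq_mul, mul_assoc]
    congr 2
    rw [ENNReal.ofReal_pow hc.le, ENNReal.ofReal, Real.toNNReal_eq_nnnorm_of_nonneg hc.le,
      ENNReal.coe_pow]
  · refine Measurable.aemeasurable ?_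
    have : (Function.uncurry fun (x : EuclideanSpace ℝ (Fin n)) (u : ℝ) =>
        (Set.Ici (∑ j, |x j| ^ p)).indicator (fun u => ENNReal.ofReal (exp (-u))) u) =
        {q : EuclideanSpace ℝ (Fin n) × ℝ | ∑ j, |q.1 j| ^ p ≤ q.2}.indicator
          fun q => ENNReal.ofReal (exp (-q.2)) := by
      ext q
      simp [Function.uncurry, Set.indicator_apply]
    rw [this]
    exact Measurable.indicator (by fun_prop)
      (measurableSet_le (hN.comp measurable_fst) measurable_snd)

/-- Permuting coordinates is an isometry that preserves the ball and carries `perp b` to `perp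
(permVec τ b)`. -/
lemma euclideanHausdorffMeasure_ellBall_inter_perp_permVec {n : ℕ} {p : ℝ}
    (τ : Equiv.Perm (Fin n)) (b : EuclideanSpace ℝ (Fin n)) (d : ℕ) :
    μHE[d] (ellBall n p ∩ perp (permVec τ b)) = μHE[d] (ellBall n p ∩ perp b) := by
  let e := LinearIsometryEquiv.piLpCongrLeft 2 ℝ ℝ τ.symm
  have he : ∀ x, e x = permVec τ x := fun x => rfl
  rw [← e.isometry.euclideanHausdorffMeasure_image (ellBall n p ∩ perp b)]
  congr 1
  ext y
  obtain ⟨x, rfl⟩ := e.surjective y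
  rw [e.injective.mem_set_image]
  refine and_congr ?_ ?_
  · simp only [ellBall, ellNorm, Set.mem_ofPred_eq, he, permVec_apply]
    rw [Equiv.sum_comp τ fun j => |x j| ^ p]
  · change inner ℝ (e x) (e b) = 0 ↔ inner ℝ x b = 0
    rw [e.inner_map_map]

/-- Here `μHE[d]` is the `d`-dimensional Hausdorff measure, normalised to agree with Lebesgue
measure on `ℝ^d`. -/
theorem theorem2p12 (n : ℕ) (p : ℝ) (hp0 : 0 < p) (hp2 : p < 2)
    (a b : EuclideanSpace ℝ (Fin n)) (ha : ‖a‖ = 1) (hb : ‖b‖ = 1)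
    (hab : Majorises (fun j => b j ^ 2) (fun j => a j ^ 2)) :
    μHE[n - 1] (ellBall n p ∩ perp a) ≤ μHE[n - 1] (ellBall n p ∩ perp b) := by
  obtain ⟨w, hw0, hw1, hw⟩ := hab.exists_weights
  have hne : ∀ c : EuclideanSpace ℝ (Fin n), ‖c‖ = 1 → c ≠ 0 := fun c hc h => by simp [h] at hc
  have ha0 := hne a ha
  have hb0 : ∀ τ, permVec τ b ≠ 0 := fun τ => hne _ ((norm_permVec τ b).trans hb)
  have := sFinite_restrict_perp ha0
  have := fun τ => sFinite_restrict_perp (hb0 τ)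
  -- Averaging the hyperplane measures with the Rado weights turns the convexity bound into a
  -- comparison of two measures.
  let ν' : Measure (EuclideanSpace ℝ (Fin n)) :=
    Measure.sum fun τ => ENNReal.ofReal (w τ) • (μHE[n - 1]).restrict (perp (permVec τ b))
  have hν' : ∀ f : EuclideanSpace ℝ (Fin n) → ℝ≥0∞, ∫⁻ x, f x ∂ν' =
      ∑ τ, ENNReal.ofReal (w τ) * ∫⁻ x in perp (permVec τ b), f x ∂μHE[n - 1] := by
    intro f
    simp only [ν', lintegral_sum_measure, lintegral_smul_measure, tsum_fintype, smul_eq_mul]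
  have key := lintegral_exp_neg_sum_abs_rpow_le (ν := (μHE[n - 1]).restrict (perp a)) (ν' := ν')
    hp0 hp2 (fun s hs => by
      rw [hν']
      exact lintegral_gaussianWeight_perp_le ha hb hw0 hw1 hw hs)
    (fun ε hε => (lintegral_gaussianWeight_const_perp_lt_top ha0 hε).ne)
    (fun ε hε => by
      rw [hν']
      exact ENNReal.sum_ne_top.2 fun τ _ => ENNReal.mul_ne_top ENNReal.ofReal_ne_top
        (lintegral_gaussianWeight_const_perp_lt_top (hb0 τ) hε).ne)
  rw [hν', lintegral_exp_neg_perp hp0 ha0] at key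
  simp_rw [fun τ => lintegral_exp_neg_perp hp0 (hb0 τ),
    euclideanHausdorffMeasure_ellBall_inter_perp_permVec] at key
  rw [← Finset.sum_mul, ← ENNReal.ofReal_sum_of_nonneg fun τ _ => hw0 τ, hw1, ENNReal.ofReal_one,
    one_mul] at key
  exact (ENNReal.mul_le_mul_iff_right (sectionFactor_ne_zero _ _)
    (sectionFactor_ne_top _ hp0)).1 key
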